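/- Let $\mathbb{O}=\{x_1+x_2k : x_1,x_2\in\mathbb{H}\}$ be the real algebra of octonions, with product $(x_1+x_2k)(y_1+y_2k)=x_1y_1-\bar y_2x_2+(x_2\bar y_1+y_2x_1)k$ and conjugation $\overline{x_1+x_2k}=\bar x_1-x_2k$. For $\alpha\in\mathbb{O}$ let $\mathbb{S}_\alpha=\{\mathrm{Re}(\alpha)+|\mathrm{Im}(\alpha)|\,I : I\in\mathbb{O},\ I^2=-1\}$ be its conjugacy class. A (slice) regular octonionic polynomial is a function $f(w)=\sum_{i=0}^n w^ia_i$ of $w\in\mathbb{O}$ with $a_i\in\mathbb{O}$; it has degree $n$ if $a_n\neq 0$. For $f=\sum_i w^ia_i$ and $g=\sum_j w^jb_j$ put $f*g=\sum_k w^k\bigl(\sum_{i+j=k}a_ib_j\bigr)$, $\bar f=\sum_i w^i\bar a_i$, $N(f)=f*\bar f$ (the normal polynomial), and let $V(f)$ be the set of zeros of $f$ in $\mathbb{O}$. Let $\Delta_\alpha=N(w-\alpha)=w^2-w(\alpha+\bar\alpha)+|\alpha|^2$, and let $\Delta_\alpha^s$ denote its powers for $*$. A polynomial $d$ divides $g$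 ($d\mid g$) if $g=d*h$ for some regular octonionic polynomial $h$. A zero $\alpha\in V(f)$ is called *real* if $\alpha\in\mathbb{R}$, *spherical* if $\alpha\notin\mathbb{R}$ and $\mathbb{S}_\alpha\subset V(f)$, and *isolated* if it is neither real nor spherical. A zero $\alpha\in V(f)$ has multiplicity $m_f(\alpha)=s$ if $\Delta_\alpha^s\mid N(f)$ and $\Delta_\alpha^{s+1}\nmid N(f)$. **Theorem (Fundamental theorem of algebra).** Let $f$ be a regular octonionic polynomial of degree $n>0$. Then $V(f)$ is non-empty, the number $k$ of distinct conjugacy classes of elements of $V(f)$ is finite and at most $n$, and every zero of $f$ has a well-defined multiplicity. More precisely, $f$ has finitely many real zeros and finitely many isolated zeros, and its spherical zeros form finitely many conjugacy classes; and if $\alpha_1,\dots,\alpha_r$ are the distinct real zeros of $f$, $\alpha_{r+1},\dots,\alpha_{r+i}$ are the distinct isolated zeros of $f$, and $\alpha_{r+i+1},\dots,\alpha_{r+i+s}$ are pairwise non-conjugate spherical zeros of $f$ such that $\bigcup_{j=1}^s\mathbb{S}_{\alpha_{r+i+j}}$ is the set of all spherical zeros of $f$, then $k=r+i+s$ and $$\sum_{j=1}^k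 m_f(\alpha_j)=n .$$ In particular, $r+i+2s\le n$. -/

import Mathlib

open scoped Quaternion

/-- The octonions `x₁ + x₂ k`, with `x₁`, `x₂` real quaternions (Cayley--Dickson doubling). -/
@[ext]
structure Octonion where
  /-- The component `x₁` of `x₁ + x₂ k`. -/
  fst : ℍ[ℝ]
  /-- The component `x₂` of `x₁ + x₂ k`. -/
  snd : ℍ[ℝ]

namespace Octonion

noncomputable instance : Zero Octonion := ⟨⟨0, 0⟩⟩
noncomputable instance : One Octonion := ⟨⟨1, 0⟩⟩
noncomputable instance : Add Octonion := ⟨fun x y => ⟨x.fst + y.fst, x.snd + y.snd⟩⟩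
noncomputable instance : Neg Octonion := ⟨fun x => ⟨-x.fst, -x.snd⟩⟩
noncomputable instance : Sub Octonion := ⟨fun x y => ⟨x.fst - y.fst, x.snd - y.snd⟩⟩

/-- `(x₁ + x₂ k)(y₁ + y₂ k) = x₁ y₁ - ȳ₂ x₂ + (x₂ ȳ₁ + y₂ x₁) k`. -/
noncomputable instance : Mul Octonion :=
  ⟨fun x y => ⟨x.fst * y.fst - star y.snd * x.snd, x.snd * star y.fst + y.snd * x.fst⟩⟩

/-- The octonionic conjugation, `x₁ + x₂ k ↦ x̄₁ - x₂ k`. -/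
noncomputable instance : Star Octonion := ⟨fun x => ⟨star x.fst, -x.snd⟩⟩

/-- Multiplication by a real scalar, componentwise. -/
noncomputable instance : SMul ℝ Octonion := ⟨fun t x => ⟨t • x.fst, t • x.snd⟩⟩

@[simp] theorem fst_zero : (0 : Octonion).fst = 0 := rfl
@[simp] theorem snd_zero : (0 : Octonion).snd = 0 := rfl
@[simp] theorem fst_one : (1 : Octonion).fst = 1 := rfl
@[simp] theorem snd_one : (1 : Octonion).snd = 0 := rfl
@[simp] theorem fst_add (x y : Octonion) : (x + y).fst = x.fst + y.fst := rfl
@[simp] theorem snd_add (x y : Octonion) : (x + y).snd = x.snd + y.snd := rfl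
@[simp] theorem fst_neg (x : Octonion) : (-x).fst = -x.fst := rfl
@[simp] theorem snd_neg (x : Octonion) : (-x).snd = -x.snd := rfl
@[simp] theorem fst_sub (x y : Octonion) : (x - y).fst = x.fst - y.fst := rfl
@[simp] theorem snd_sub (x y : Octonion) : (x - y).snd = x.snd - y.snd := rfl
@[simp] theorem fst_mul (x y : Octonion) :
    (x * y).fst = x.fst * y.fst - star y.snd * x.snd := rfl
@[simp] theorem snd_mul (x y : Octonion) :
    (x * y).snd = x.snd * star y.fst + y.snd * x.fst := rfl
@[simp] theorem fst_star (x : Octonion) : (star x).fst = star x.fst := rfl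
@[simp] theorem snd_star (x : Octonion) : (star x).snd = -x.snd := rfl
@[simp] theorem fst_smul (t : ℝ) (x : Octonion) : (t • x).fst = t • x.fst := rfl
@[simp] theorem snd_smul (t : ℝ) (x : Octonion) : (t • x).snd = t • x.snd := rfl

noncomputable instance : AddCommGroup Octonion where
  add_assoc x y z := by ext1 <;> simp [add_assoc]
  zero_add x := by ext1 <;> simp
  add_zero x := by ext1 <;> simp
  add_comm x y := by ext1 <;> simp [add_comm]
  neg_add_cancel x := by ext1 <;> simp
  sub_eq_add_neg x y := by ext1 <;> simp [sub_eq_add_neg]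
  nsmul := nsmulRec
  zsmul := zsmulRec

noncomputable instance : Module ℝ Octonion where
  one_smul x := by ext1 <;> simp
  mul_smul s t x := by ext1 <;> simp [mul_smul]
  smul_zero t := by ext1 <;> simp
  smul_add t x y := by ext1 <;> simp
  add_smul s t x := by ext1 <;> simp [add_smul]
  zero_smul x := by ext1 <;> simp

/-- The octonions form a unital, nonassociative ring. -/
noncomputable instance : NonAssocRing Octonion where
  left_distrib x y z := by ext1 <;> simp [mul_add, add_mul] <;> abel
  right_distrib x y z := by ext1 <;> simp [mul_add, add_mul] <;> abel
  zero_mul x := by ext1 <;> simp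
  mul_zero x := by ext1 <;> simp
  one_mul x := by ext1 <;> simp
  mul_one x := by ext1 <;> simp

/-- Powers: `w ^ 0 = 1`, `w ^ (m + 1) = w ^ m * w`. -/
noncomputable instance : Pow Octonion ℕ := ⟨fun w m => npowRec m w⟩

/-- The embedding of the reals into the octonions. -/
noncomputable def ofReal (t : ℝ) : Octonion := t • 1

/-- The real part of an octonion. -/
def re (x : Octonion) : ℝ := x.fst.re

/-- The imaginary part of an octonion. -/
noncomputable def im (x : Octonion) : Octonion := x - ofReal x.re

/-- The squared Euclidean norm of an octonion. -/
noncomputable def normSq (x : Octonion) : ℝ :=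
  Quaternion.normSq x.fst + Quaternion.normSq x.snd

/-- The Euclidean norm `|x|` of an octonion. -/
noncomputable def abs (x : Octonion) : ℝ := √x.normSq

/-- An octonion is real if it lies in the image of `ℝ`. -/
def IsReal (x : Octonion) : Prop := ∃ t : ℝ, x = ofReal t

/-- The sphere of imaginary units. -/
def imagUnits : Set Octonion := {I | I * I = -1}

/-- The conjugacy class of `α`: all `Re α + |Im α| I`, where `I` is an imaginary unit. -/
def conjClass (α : Octonion) : Set Octonion :=
  {β | ∃ I ∈ imagUnits, β = ofReal α.re + α.im.abs • I}

end Octonion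

/-- The (slice) regular octonionic polynomials `∑ i, w ^ i a i` with right octonionic
coefficients, given by their finitely supported coefficient sequence `a`. (The operations below
are named; in particular the product is `OctPoly.mul`, not a pointwise product.) -/
abbrev OctPoly : Type := ℕ →₀ Octonion

namespace OctPoly

/-- The value `f(w) = ∑ i, w ^ i a i`. -/
noncomputable def eval (w : Octonion) (f : OctPoly) : Octonion := f.sum fun i a => w ^ i * a

/-- `f` has degree exactly `n`. -/
def HasDegree (f : OctPoly) (n : ℕ) : Prop := f n ≠ 0 ∧ ∀ m, n < m → f m = 0

/-- The product `f ∗ g = ∑ k, w ^ k (∑ i + j = k, a i * b j)`. -/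
noncomputable def mul (f g : OctPoly) : OctPoly :=
  f.sum fun i a => g.sum fun j b => Finsupp.single (i + j) (a * b)

/-- The powers of `f` for the product `∗`. -/
noncomputable def pow (f : OctPoly) : ℕ → OctPoly
  | 0 => Finsupp.single 0 1
  | s + 1 => mul (pow f s) f

/-- The conjugate polynomial, `f̄(w) = ∑ i, w ^ i ā i`. -/
noncomputable def conj (f : OctPoly) : OctPoly :=
  Finsupp.mapRange star (by ext1 <;> simp) f

/-- The normal polynomial `N(f) = f ∗ f̄`. -/
noncomputable def normal (f : OctPoly) : OctPoly := mul f (conj f)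

/-- The polynomial `w - α`. -/
noncomputable def linear (α : Octonion) : OctPoly :=
  Finsupp.single 1 1 - Finsupp.single 0 α

/-- The characteristic polynomial `Δ_α = N(w - α)` of `α`. -/
noncomputable def charPoly (α : Octonion) : OctPoly := normal (linear α)

/-- `d` divides `f`, that is, `f = d ∗ h` for some polynomial `h`. -/
def Divides (d f : OctPoly) : Prop := ∃ h : OctPoly, f = mul d h

/-- The zero set `V(f)`. -/
def zeroSet (f : OctPoly) : Set Octonion := {α | eval α f = 0}

/-- The real zeros of `f`. -/
def realZeros (f : OctPoly) : Set Octonion := {α | α ∈ zeroSet f ∧ α.IsReal}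

/-- The spherical zeros of `f`: the nonreal `α` whose whole conjugacy class lies in `V(f)`. -/
def sphericalZeros (f : OctPoly) : Set Octonion :=
  {α | α ∈ zeroSet f ∧ ¬ α.IsReal ∧ α.conjClass ⊆ zeroSet f}

/-- The (nonreal) isolated zeros of `f`: those that are neither real nor spherical. -/
def isolatedZeros (f : OctPoly) : Set Octonion :=
  {α | α ∈ zeroSet f ∧ ¬ α.IsReal ∧ ¬ α.conjClass ⊆ zeroSet f}

/-- `α` is a zero of `f` of multiplicity `s`: `Δ_α ^ s ∣ N(f)` and `Δ_α ^ (s + 1) ∤ N(f)`. -/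
def IsZeroOfMultiplicity (f : OctPoly) (α : Octonion) (s : ℕ) : Prop :=
  α ∈ zeroSet f ∧ Divides (pow (charPoly α) s) (normal f) ∧
    ¬ Divides (pow (charPoly α) (s + 1)) (normal f)

/-- The multiplicity `m_f(α)`: the `s` with `IsZeroOfMultiplicity f α s` (the supremum is only a
way to pick this number). -/
noncomputable def zeroMultiplicity (f : OctPoly) (α : Octonion) : ℕ :=
  sSup {s | IsZeroOfMultiplicity f α s}

/-- `R` lists the real zeros of `f`, `I` lists the isolated zeros of `f`, and `S` consists of
pairwise nonconjugate spherical zeros of `f` whose conjugacy classes cover all of them. -/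
structure IsZeroSystem (f : OctPoly) (R I S : Finset Octonion) : Prop where
  coe_real : (R : Set Octonion) = realZeros f
  coe_isolated : (I : Set Octonion) = isolatedZeros f
  spherical_subset : (S : Set Octonion) ⊆ sphericalZeros f
  nonconjugate : ∀ β ∈ S, ∀ γ ∈ S, β ≠ γ → β ∉ γ.conjClass
  cover : (⋃ β ∈ S, β.conjClass) = sphericalZeros f

end OctPoly

/-! Taking real coordinates of the coefficients of f gives eight real polynomials pⱼ, and N(f) is
the real polynomial P = ∑ pⱼ², of degree 2n (`normal_eq_ofPoly`, `natDegree_realNormal`). On the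
sphere of points s + tI, f is affine in I: with z = s + it its value is b + Ic, where b and c have
as coordinates the real and imaginary parts of the pⱼ(z) (`eval_ofReal_add_smul`). An imaginary unit
I with b + Ic = 0 exists iff |b| = |c| and b ⊥ c (`exists_imagUnit_add_mul_eq_zero_iff`), which are
the real and imaginary parts of the equation P(z) = 0. So the classes meeting V(f) correspond to the
roots z of P with Im z ≥ 0.

Under this correspondence m_f(α) is the order of (X − z)(X − z̄) in P: the multiplicity of z if z is
not real, half of it if z is real. The half is exact, because real roots of a sum of squares have
even multiplicity. As nonreal roots come in conjugate pairs, these orders add up to half the degree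
of P, which is n (`sum_quadOrder_upperRoots`).

Two zeros on one sphere force b = c = 0. Hence an isolated zero is alone in its class, while at a
spherical zero every pⱼ vanishes at z, so its multiplicity is at least 2. -/

/-! ### Octonion arithmetic and the norm -/

namespace Octonion

/-- The eight real coordinates of an octonion. -/
noncomputable def coord : Octonion →ₗ[ℝ] (Fin 8 → ℝ) where
  toFun x := ![x.fst.re, x.fst.imI, x.fst.imJ, x.fst.imK,
    x.snd.re, x.snd.imI, x.snd.imJ, x.snd.imK]
  map_add' x y := by ext j; fin_cases j <;> simp
  map_smul' t x := by ext j; fin_cases j <;> simp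

theorem coord_apply (x : Octonion) : coord x = ![x.fst.re, x.fst.imI, x.fst.imJ, x.fst.imK,
    x.snd.re, x.snd.imI, x.snd.imJ, x.snd.imK] := rfl

theorem coord_injective : Function.Injective coord := by
  intro x y h
  have hj := fun j => congrFun h j
  ext
  · exact hj 0
  · exact hj 1
  · exact hj 2
  · exact hj 3
  · exact hj 4
  · exact hj 5
  · exact hj 6
  · exact hj 7

theorem normSq_eq_sum (x : Octonion) : x.normSq = ∑ j, coord x j ^ 2 := by
  simp [normSq, Quaternion.normSq_def', coord_apply, Fin.sum_univ_eight]
  ring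

theorem coord_ofReal_zero (t : ℝ) : coord (ofReal t) 0 = t := by
  simp [coord_apply, ofReal]

theorem ofReal_zero : ofReal 0 = 0 := by simp [ofReal]

theorem ofReal_injective : Function.Injective ofReal := fun s t h => by
  have := congrArg (fun x => coord x 0) h
  simpa only [coord_ofReal_zero] using this

theorem ofReal_sum {ι : Type*} (s : Finset ι) (t : ι → ℝ) :
    ofReal (∑ i ∈ s, t i) = ∑ i ∈ s, ofReal (t i) := by
  simp [ofReal, Finset.sum_smul]

theorem ofReal_mul_eq_smul (t : ℝ) (x : Octonion) : ofReal t * x = t • x := by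
  ext <;> simp [ofReal]

theorem ofReal_mul_ofReal (s t : ℝ) : ofReal s * ofReal t = ofReal (s * t) := by
  rw [ofReal_mul_eq_smul, ofReal, ofReal, mul_smul]

theorem smul_mul (t : ℝ) (x y : Octonion) : (t • x) * y = t • (x * y) := by
  ext <;> simp <;> ring

theorem mul_smul' (t : ℝ) (x y : Octonion) : x * (t • y) = t • (x * y) := by
  ext <;> simp <;> ring

/-- Polarization of the norm; this is what makes the coefficients of N(f) real. -/
theorem mul_star_add_mul_star (x y : Octonion) :
    x * star y + y * star x = ofReal (2 * ∑ j, coord x j * coord y j) := by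
  ext <;> simp [ofReal, coord_apply, Fin.sum_univ_eight] <;> ring

theorem re_mul_star (x y : Octonion) : (x * star y).re = ∑ j, coord x j * coord y j := by
  simp [re, coord_apply, Fin.sum_univ_eight]; ring

theorem sum_coord_mul_self_mul (x y : Octonion) :
    ∑ j, coord (x * y) j * coord y j = x.re * y.normSq := by
  simp [re, coord_apply, Fin.sum_univ_eight, normSq, Quaternion.normSq_def']; ring

/-- An instance of alternativity, which replaces associativity when dividing on the right. -/
theorem mul_star_mul_self (x y : Octonion) : (x * star y) * y = y.normSq • x := by
  ext <;> simp [normSq, Quaternion.normSq_def'] <;> ring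

/-- Degen's eight-square identity; it excludes zero divisors. -/
theorem normSq_mul (x y : Octonion) : (x * y).normSq = x.normSq * y.normSq := by
  simp [normSq, Quaternion.normSq_def']; ring

theorem mul_self (x : Octonion) : x * x = (2 * x.re) • x - ofReal x.normSq := by
  ext <;> simp [re, ofReal, normSq, Quaternion.normSq_def'] <;> ring

theorem normSq_star (x : Octonion) : (star x).normSq = x.normSq := by
  simp [normSq]

theorem normSq_smul (t : ℝ) (x : Octonion) : (t • x).normSq = t ^ 2 * x.normSq := by
  simp [normSq, Quaternion.normSq_smul]; ring

theorem normSq_nonneg (x : Octonion) : 0 ≤ x.normSq := by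
  rw [normSq_eq_sum]; positivity

theorem normSq_eq_zero {x : Octonion} : x.normSq = 0 ↔ x = 0 := by
  constructor
  · intro h
    rw [normSq_eq_sum, Finset.sum_eq_zero_iff_of_nonneg (fun _ _ => sq_nonneg _)] at h
    apply coord_injective
    ext j
    simpa using h j (Finset.mem_univ j)
  · rintro rfl; simp [normSq]

theorem mul_eq_zero_iff {x y : Octonion} : x * y = 0 ↔ x = 0 ∨ y = 0 := by
  rw [← normSq_eq_zero, normSq_mul, mul_eq_zero, normSq_eq_zero, normSq_eq_zero]

theorem re_ofReal (t : ℝ) : (ofReal t).re = t := by simp [ofReal, re]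

theorem re_add (x y : Octonion) : (x + y).re = x.re + y.re := by simp [re]

theorem re_smul (t : ℝ) (x : Octonion) : (t • x).re = t * x.re := by simp [re]

theorem normSq_neg (x : Octonion) : (-x).normSq = x.normSq := by simp [normSq]

theorem re_neg (x : Octonion) : (-x).re = -x.re := by simp [re]

/-! ### Imaginary units and conjugacy classes -/

/-- By the quadratic equation of x, x² = −1 makes 2 Re(x) x real. If Re x ≠ 0 then x itself is real,
and its square cannot be negative. -/
theorem mem_imagUnits_iff {x : Octonion} : x ∈ imagUnits ↔ x.re = 0 ∧ x.normSq = 1 := by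
  constructor
  · intro h
    have h1 : x * x = -1 := h
    have h2 := h1
    rw [mul_self, sub_eq_iff_eq_add] at h2
    have hre : x.re = 0 := by
      by_contra hx
      have hx2 : x = ofReal ((2 * x.re)⁻¹ * (x.normSq - 1)) := by
        have h3 : (2 * x.re) • x = ofReal (x.normSq - 1) := by
          rw [h2, ofReal, ofReal, sub_smul, one_smul]; abel
        rw [ofReal, mul_smul, ← ofReal, ← h3, smul_smul, inv_mul_cancel₀ (by simpa using hx),
          one_smul]
      rw [hx2, ofReal_mul_ofReal] at h1
      have h4 : (-1 : Octonion) = ofReal (-1) := by simp [ofReal]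
      rw [h4] at h1
      have := ofReal_injective h1
      nlinarith [sq_nonneg ((2 * x.re)⁻¹ * (x.normSq - 1))]
    refine ⟨hre, ?_⟩
    rw [hre] at h2
    have := congrArg re h2
    have h5 : (-1 : Octonion) = ofReal (-1) := by simp [ofReal]
    rw [h5, re_add, re_smul, re_ofReal, re_ofReal] at this
    linarith
  · rintro ⟨h1, h2⟩
    change x * x = -1
    rw [mul_self, h1, h2]; simp [ofReal]

theorem neg_mem_imagUnits {x : Octonion} (h : x ∈ imagUnits) : -x ∈ imagUnits := by
  rw [mem_imagUnits_iff] at *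
  simpa [re_neg, normSq_neg] using h

theorem imagUnits_nonempty : imagUnits.Nonempty :=
  ⟨⟨0, 1⟩, mem_imagUnits_iff.2 (by simp [re, normSq])⟩

theorem re_im (x : Octonion) : x.im.re = 0 := by simp [im, re, ofReal]

theorem abs_nonneg (x : Octonion) : 0 ≤ x.abs := Real.sqrt_nonneg _

theorem abs_sq (x : Octonion) : x.abs ^ 2 = x.normSq := Real.sq_sqrt x.normSq_nonneg

theorem abs_eq_zero {x : Octonion} : x.abs = 0 ↔ x = 0 := by
  rw [← normSq_eq_zero, ← abs_sq, sq_eq_zero_iff]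

theorem exists_imagUnit (x : Octonion) :
    ∃ I ∈ imagUnits, x = ofReal x.re + x.im.abs • I := by
  have hx : x = ofReal x.re + x.im := by simp [im]
  by_cases h : x.im = 0
  · obtain ⟨I, hI⟩ := imagUnits_nonempty
    refine ⟨I, hI, ?_⟩
    rw [abs_eq_zero.2 h, zero_smul]
    simpa [h] using hx
  · have h' : x.im.abs ≠ 0 := fun h0 => h (abs_eq_zero.1 h0)
    refine ⟨x.im.abs⁻¹ • x.im, mem_imagUnits_iff.2 ⟨?_, ?_⟩, ?_⟩
    · rw [re_smul, re_im, mul_zero]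
    · rw [normSq_smul, ← abs_sq, ← mul_pow, inv_mul_cancel₀ h', one_pow]
    · rw [smul_smul, mul_inv_cancel₀ h', one_smul]; exact hx

/-- The point of the closed upper half plane that represents the conjugacy class of `x`. -/
noncomputable def toComplex (x : Octonion) : ℂ := ⟨x.re, x.im.abs⟩

theorem toComplex_im_nonneg (x : Octonion) : 0 ≤ x.toComplex.im := abs_nonneg _

theorem toComplex_ofReal_add_smul {I : Octonion} (hI : I ∈ imagUnits) (s : ℝ) {t : ℝ}
    (ht : 0 ≤ t) : (ofReal s + t • I).toComplex = ⟨s, t⟩ := by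
  obtain ⟨h1, h2⟩ := mem_imagUnits_iff.1 hI
  have hre : (ofReal s + t • I).re = s := by rw [re_add, re_ofReal, re_smul, h1]; simp
  have him : (ofReal s + t • I).im = t • I := by rw [im, hre]; simp
  rw [toComplex, hre, him, abs, normSq_smul, h2, mul_one, Real.sqrt_sq ht]

theorem mem_conjClass_iff {x y : Octonion} : y ∈ x.conjClass ↔ y.toComplex = x.toComplex := by
  constructor
  · rintro ⟨I, hI, rfl⟩
    rw [toComplex_ofReal_add_smul hI _ (abs_nonneg _)]; rfl
  · intro h
    obtain ⟨I, hI, hy⟩ := exists_imagUnit y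
    have h1 : y.re = x.re := congrArg Complex.re h
    have h2 : y.im.abs = x.im.abs := congrArg Complex.im h
    exact ⟨I, hI, by rw [← h1, ← h2]; exact hy⟩

theorem conjClass_eq_iff {x y : Octonion} :
    x.conjClass = y.conjClass ↔ x.toComplex = y.toComplex := by
  constructor
  · intro h
    rw [← mem_conjClass_iff, ← h, mem_conjClass_iff]
  · intro h
    ext z
    rw [mem_conjClass_iff, mem_conjClass_iff, h]

theorem isReal_iff {x : Octonion} : x.IsReal ↔ x.toComplex.im = 0 := by
  constructor
  · rintro ⟨t, rfl⟩
    exact abs_eq_zero.2 (by simp [im, re_ofReal])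
  · intro h
    have : x.im = 0 := abs_eq_zero.1 h
    exact ⟨x.re, by simpa [im, sub_eq_zero] using this⟩

theorem toComplex_injOn_isReal : Set.InjOn toComplex {x | x.IsReal} := by
  rintro _ ⟨s, rfl⟩ _ ⟨t, rfl⟩ h
  have := congrArg Complex.re h
  simp only [toComplex, re_ofReal] at this
  rw [this]

theorem pow_zero' (x : Octonion) : x ^ 0 = 1 := rfl

theorem pow_succ' (x : Octonion) (m : ℕ) : x ^ (m + 1) = x ^ m * x := rfl

/-- The plane ℝ + ℝI is a copy of ℂ. -/
theorem pow_ofReal_add_smul {I : Octonion} (hI : I ∈ imagUnits) (z : ℂ) (m : ℕ) :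
    (ofReal z.re + z.im • I) ^ m = ofReal (z ^ m).re + (z ^ m).im • I := by
  induction m with
  | zero => simp [pow_zero', ofReal]
  | succ m ih =>
    have hI' : I * I = -1 := hI
    rw [pow_succ', ih, pow_succ]
    simp only [ofReal, mul_add, add_mul, smul_mul, mul_smul', hI', one_mul, mul_one,
      Complex.mul_re, Complex.mul_im]
    module

theorem exists_imagUnit_add_mul_eq_zero_iff (b c : Octonion) :
    (∃ I ∈ imagUnits, b + I * c = 0) ↔
      b.normSq = c.normSq ∧ ∑ j, coord b j * coord c j = 0 := by
  constructor
  · rintro ⟨I, hI, h⟩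
    obtain ⟨h1, h2⟩ := mem_imagUnits_iff.1 hI
    have hb : b = -I * c := by rw [neg_mul]; exact eq_neg_of_add_eq_zero_left h
    subst hb
    rw [normSq_mul, normSq_neg, h2, one_mul, sum_coord_mul_self_mul, re_neg, h1]
    simp
  · rintro ⟨h1, h2⟩
    by_cases hc : c = 0
    · obtain ⟨I, hI⟩ := imagUnits_nonempty
      have hb : b = 0 := by rw [← normSq_eq_zero, h1, hc]; simp [normSq]
      exact ⟨I, hI, by rw [hb, hc]; simp⟩
    · have hc' : c.normSq ≠ 0 := fun h => hc (normSq_eq_zero.1 h)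
      -- The only candidate is I = −b c⁻¹, with c⁻¹ = c̄/|c|². Orthogonality makes it imaginary, and
      -- equality of the norms makes it a unit.
      refine ⟨(-c.normSq⁻¹) • (b * star c), mem_imagUnits_iff.2 ⟨?_, ?_⟩, ?_⟩
      · rw [re_smul, re_mul_star, h2, mul_zero]
      · rw [normSq_smul, normSq_mul, normSq_star, h1]; field_simp
      · rw [smul_mul, mul_star_mul_self, smul_smul, neg_mul, inv_mul_cancel₀ hc']; simp

theorem eq_zero_of_add_mul_eq_zero {b c I J : Octonion} (hIJ : I ≠ J) (hI : b + I * c = 0)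
    (hJ : b + J * c = 0) : b = 0 ∧ c = 0 := by
  have h : (I - J) * c = 0 := by
    rw [sub_mul, sub_eq_zero]; exact add_left_cancel (hI.trans hJ.symm)
  have hc : c = 0 := (mul_eq_zero_iff.1 h).resolve_left (sub_ne_zero.2 hIJ)
  subst hc
  simpa using hI

end Octonion

/-! ### Real quadratic factors and sums of squares -/

namespace Polynomial

open scoped ComplexConjugate

/-- The real quadratic polynomial with roots `z` and `conj z`. -/
noncomputable def quadFactor (z : ℂ) : ℝ[X] := X ^ 2 - C (2 * z.re) * X + C (Complex.normSq z)

theorem map_quadFactor (z : ℂ) :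
    (quadFactor z).map (algebraMap ℝ ℂ) = (X - C z) * (X - C (conj z)) := by
  have h1 : ((2 * z.re : ℝ) : ℂ) = z + conj z := by rw [Complex.add_conj]
  have h2 : ((Complex.normSq z : ℝ) : ℂ) = z * conj z := by rw [Complex.mul_conj]
  rw [quadFactor, Polynomial.map_add, Polynomial.map_sub, Polynomial.map_mul,
    Polynomial.map_pow, map_X, map_C, map_C, Complex.coe_algebraMap, h1, h2, C_add, C_mul]
  ring

theorem map_conj_map (P : ℝ[X]) :
    (P.map (algebraMap ℝ ℂ)).map (starRingEnd ℂ) = P.map (algebraMap ℝ ℂ) := by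
  rw [map_map]
  congr 1
  ext x
  simp

theorem rootMultiplicity_conj (P : ℝ[X]) (z : ℂ) :
    rootMultiplicity (conj z) (P.map (algebraMap ℝ ℂ)) =
      rootMultiplicity z (P.map (algebraMap ℝ ℂ)) := by
  rw [eq_rootMultiplicity_map (f := starRingEnd ℂ) (star_injective) z, map_conj_map]

/-- The multiplicity of `quadFactor z` as a factor of a real polynomial. -/
noncomputable def quadOrder (P : ℝ[X]) (z : ℂ) : ℕ :=
  if z.im = 0 then rootMultiplicity z (P.map (algebraMap ℝ ℂ)) / 2
  else rootMultiplicity z (P.map (algebraMap ℝ ℂ))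

/-- Over ℂ the quadratic is (X − z)(X − z̄). For nonreal z the two factors are coprime and divide P
to the same order. For real z they coincide, so each power uses up two from the multiplicity. -/
theorem quadFactor_pow_dvd_iff {P : ℝ[X]} (hP : P ≠ 0) (z : ℂ) (s : ℕ) :
    quadFactor z ^ s ∣ P ↔ s ≤ quadOrder P z := by
  have hP' : P.map (algebraMap ℝ ℂ) ≠ 0 :=
    (Polynomial.map_ne_zero_iff (algebraMap ℝ ℂ).injective).2 hP
  rw [← map_dvd_map' (algebraMap ℝ ℂ), Polynomial.map_pow, map_quadFactor, mul_pow, quadOrder]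
  split_ifs with h
  · rw [Complex.conj_eq_iff_im.2 h, ← pow_add, ← le_rootMultiplicity_iff hP']
    omega
  · have hne : z ≠ conj z := fun h' => h (Complex.conj_eq_iff_im.1 h'.symm)
    constructor
    · intro hd
      exact (le_rootMultiplicity_iff hP').2 (dvd_of_mul_right_dvd hd)
    · intro hs
      refine IsCoprime.mul_dvd (IsCoprime.pow ?_) ((le_rootMultiplicity_iff hP').1 hs)
        ((le_rootMultiplicity_iff hP').1 (by rwa [rootMultiplicity_conj]))
      exact isCoprime_X_sub_C_of_isUnit_sub (sub_ne_zero.2 hne).isUnit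

theorem eval_eq_zero_of_sum_sq {ι : Type*} [Fintype ι] (p : ι → ℝ[X]) (x : ℝ)
    (h : (∑ i, p i ^ 2).eval x = 0) (i : ι) : (p i).eval x = 0 := by
  simp only [eval_finsetSum, eval_pow] at h
  rw [Finset.sum_eq_zero_iff_of_nonneg (fun _ _ => sq_nonneg _)] at h
  simpa using h i (Finset.mem_univ i)

/-- A real root x of a sum of squares is a root of every summand. Dividing by (X − x)² leaves a sum
of squares again, of multiplicity smaller by 2. -/
theorem even_rootMultiplicity_sum_sq {ι : Type*} [Fintype ι] (x : ℝ) (p : ι → ℝ[X])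
    (h0 : ∑ i, p i ^ 2 ≠ 0) : Even (rootMultiplicity x (∑ i, p i ^ 2)) := by
  induction hn : rootMultiplicity x (∑ i, p i ^ 2) using Nat.strong_induction_on generalizing p with
  | _ n ih =>
    by_cases hx : (∑ i, p i ^ 2).eval x = 0
    · have hd := fun i => dvd_iff_isRoot.2 (eval_eq_zero_of_sum_sq p x hx i)
      choose q hq using hd
      have hs : ∑ i, p i ^ 2 = (∑ i, q i ^ 2) * (X - C x) ^ 2 := by
        rw [Finset.sum_mul]
        exact Finset.sum_congr rfl fun i _ => by rw [hq i]; ring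
      have hq0 : ∑ i, q i ^ 2 ≠ 0 := by
        intro h; rw [h, zero_mul] at hs; exact h0 hs
      rw [hs, rootMultiplicity_mul_X_sub_C_pow hq0] at hn
      rw [← hn]
      exact (ih _ (by omega) q hq0 rfl).add even_two
    · rw [rootMultiplicity_eq_zero hx] at hn
      rw [← hn]; exact Even.zero

theorem two_mul_quadOrder_of_im_eq_zero {ι : Type*} [Fintype ι] (p : ι → ℝ[X])
    (h0 : ∑ i, p i ^ 2 ≠ 0) {z : ℂ} (hz : z.im = 0) :
    2 * quadOrder (∑ i, p i ^ 2) z =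
      rootMultiplicity z ((∑ i, p i ^ 2).map (algebraMap ℝ ℂ)) := by
  have hz' : z = algebraMap ℝ ℂ z.re := by apply Complex.ext <;> simp [hz]
  rw [quadOrder, if_pos hz, hz',
    ← eq_rootMultiplicity_map (f := algebraMap ℝ ℂ) (algebraMap ℝ ℂ).injective]
  exact Nat.two_mul_div_two_of_even (even_rootMultiplicity_sum_sq _ p h0)

/-- The complex roots of a real polynomial in the closed upper half plane. -/
noncomputable def upperRoots (P : ℝ[X]) : Finset ℂ :=
  (P.map (algebraMap ℝ ℂ)).roots.toFinset.filter fun z => 0 ≤ z.im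

theorem mem_upperRoots {P : ℝ[X]} (hP : P ≠ 0) {z : ℂ} :
    z ∈ upperRoots P ↔ aeval z P = 0 ∧ 0 ≤ z.im := by
  rw [upperRoots, Finset.mem_filter, Multiset.mem_toFinset,
    mem_roots ((Polynomial.map_ne_zero_iff (algebraMap ℝ ℂ).injective).2 hP), IsRoot.def,
    eval_map_algebraMap]

theorem sum_quadOrder_upperRoots {ι : Type*} [Fintype ι] (p : ι → ℝ[X])
    (h0 : ∑ i, p i ^ 2 ≠ 0) :
    2 * ∑ z ∈ upperRoots (∑ i, p i ^ 2), quadOrder (∑ i, p i ^ 2) z =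
      (∑ i, p i ^ 2).natDegree := by
  set P := ∑ i, p i ^ 2 with hPdef
  set m : ℂ → ℕ := fun z => rootMultiplicity z (P.map (algebraMap ℝ ℂ)) with hm
  set T := (P.map (algebraMap ℝ ℂ)).roots.toFinset with hT
  have hP' : P.map (algebraMap ℝ ℂ) ≠ 0 :=
    (Polynomial.map_ne_zero_iff (algebraMap ℝ ℂ).injective).2 h0
  -- The algebraic closedness of ℂ enters here.
  have htotal : ∑ z ∈ T, m z = P.natDegree := by
    rw [← natDegree_map (algebraMap ℝ ℂ), (IsAlgClosed.splits _).natDegree_eq_card_roots,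
      ← Multiset.toFinset_sum_count_eq]
    exact Finset.sum_congr rfl fun z _ => (count_roots _).symm
  have hlower : ∑ z ∈ T with ¬ 0 ≤ z.im, m z = ∑ z ∈ T with 0 < z.im, m z := by
    have hmem : ∀ z, z ∈ T → conj z ∈ T := by
      intro z hz
      rw [hT, Multiset.mem_toFinset, mem_roots hP', ← rootMultiplicity_pos hP'] at *
      rwa [rootMultiplicity_conj]
    refine Finset.sum_nbij' (fun z => conj z) (fun z => conj z) ?_ ?_ ?_ ?_ ?_
    · intro z hz
      rw [Finset.mem_filter] at *
      exact ⟨hmem z hz.1, by simpa using hz.2⟩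
    · intro z hz
      rw [Finset.mem_filter] at *
      exact ⟨hmem z hz.1, by simpa using hz.2⟩
    · simp
    · simp
    · intro z _
      exact (rootMultiplicity_conj P z).symm
  have hupper : ∑ z ∈ T with 0 ≤ z.im, m z + ∑ z ∈ T with 0 < z.im, m z =
      2 * ∑ z ∈ T with 0 ≤ z.im, quadOrder P z := by
    have hfilter : {z ∈ T | 0 < z.im} = {z ∈ {z ∈ T | 0 ≤ z.im} | 0 < z.im} := by
      rw [Finset.filter_filter]
      exact Finset.filter_congr fun z _ => ⟨fun h => ⟨h.le, h⟩, fun h => h.2⟩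
    rw [hfilter, Finset.sum_filter (s := {z ∈ T | 0 ≤ z.im}), ← Finset.sum_add_distrib,
      Finset.mul_sum]
    refine Finset.sum_congr rfl fun z hz => ?_
    -- A real root counts once, with even multiplicity; a nonreal one counts twice, for itself and
    -- its mirror image.
    rcases (Finset.mem_filter.1 hz).2.eq_or_lt with h | h
    · rw [if_neg (by rw [← h]; exact lt_irrefl _), add_zero]
      exact (two_mul_quadOrder_of_im_eq_zero p h0 h.symm).symm
    · rw [if_pos h, quadOrder, if_neg h.ne', two_mul]
  rw [← htotal, ← Finset.sum_filter_add_sum_filter_not T (fun z => 0 ≤ z.im), hlower, hupper]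
  rfl

theorem one_le_quadOrder {ι : Type*} [Fintype ι] (p : ι → ℝ[X])
    (h0 : ∑ i, p i ^ 2 ≠ 0) {z : ℂ} (hz : aeval z (∑ i, p i ^ 2) = 0) :
    1 ≤ quadOrder (∑ i, p i ^ 2) z := by
  have hpos : 0 < rootMultiplicity z ((∑ i, p i ^ 2).map (algebraMap ℝ ℂ)) := by
    rw [rootMultiplicity_pos ((Polynomial.map_ne_zero_iff (algebraMap ℝ ℂ).injective).2 h0),
      IsRoot.def, eval_map_algebraMap, hz]
  by_cases h : z.im = 0
  · have := two_mul_quadOrder_of_im_eq_zero p h0 h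
    omega
  · rw [quadOrder, if_neg h]; exact hpos

theorem two_le_quadOrder {ι : Type*} [Fintype ι] (p : ι → ℝ[X])
    (h0 : ∑ i, p i ^ 2 ≠ 0) {z : ℂ} (hz : z.im ≠ 0) (hp : ∀ i, aeval z (p i) = 0) :
    2 ≤ quadOrder (∑ i, p i ^ 2) z := by
  rw [quadOrder, if_neg hz, le_rootMultiplicity_iff
    ((Polynomial.map_ne_zero_iff (algebraMap ℝ ℂ).injective).2 h0), Polynomial.map_sum]
  refine Finset.dvd_sum fun i _ => ?_
  rw [Polynomial.map_pow]
  refine pow_dvd_pow_of_dvd (dvd_iff_isRoot.2 ?_) 2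
  rw [IsRoot.def, eval_map_algebraMap, hp]

end Polynomial

/-! ### The normal polynomial as a real polynomial -/

namespace OctPoly

open Octonion Polynomial

theorem mul_apply (f g : OctPoly) (k : ℕ) :
    mul f g k = ∑ p ∈ Finset.HasAntidiagonal.antidiagonal k, f p.1 * g p.2 := by
  have hsum : ∀ f : OctPoly, mul f g k =
      f.sum fun i a => if i ≤ k then a * g (k - i) else 0 := by
    intro f
    rw [mul, Finsupp.sum_apply]
    refine Finsupp.sum_congr fun i _ => ?_
    rw [Finsupp.sum_apply]
    split_ifs with h
    · rw [Finsupp.sum, Finset.sum_eq_single (k - i)]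
      · rw [Nat.add_sub_cancel' h, Finsupp.single_eq_same]
      · intro j _ hj
        exact Finsupp.single_eq_of_ne (by omega)
      · intro hj
        rw [Finsupp.notMem_support_iff.1 hj]
        simp
    · refine Finset.sum_eq_zero fun j _ => Finsupp.single_eq_of_ne (by omega)
  rw [hsum, Finset.Nat.sum_antidiagonal_eq_sum_range_succ (fun i j => f i * g j), Finsupp.sum]
  rw [← Finset.sum_filter]
  refine Finset.sum_subset_zero_on_sdiff ?_ ?_ fun _ _ => rfl
  · intro i hi
    simp only [Finset.mem_filter, Finset.mem_range] at *
    omega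
  · intro i hi
    simp only [Finset.mem_filter, Finset.mem_range, Finset.mem_sdiff, not_and,
      Finsupp.mem_support_iff] at hi
    have : f i = 0 := by
      by_contra h
      exact hi.2 h (by omega)
    rw [this, zero_mul]

/-- A real polynomial, seen as an octonionic polynomial. -/
noncomputable def ofPoly (p : ℝ[X]) : OctPoly :=
  Finsupp.onFinset p.support (fun i => ofReal (p.coeff i)) fun i hi => by
    rw [mem_support_iff]
    intro h
    exact hi (by rw [h, ofReal_zero])

theorem ofPoly_apply (p : ℝ[X]) (i : ℕ) : ofPoly p i = ofReal (p.coeff i) := rfl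

theorem ofPoly_one : ofPoly 1 = Finsupp.single 0 1 := by
  ext1 i
  rw [ofPoly_apply, coeff_one, Finsupp.single_apply]
  by_cases h : i = 0 <;> simp [h, ofReal, eq_comm]

theorem ofPoly_mul (p q : ℝ[X]) : ofPoly (p * q) = mul (ofPoly p) (ofPoly q) := by
  ext1 k
  rw [mul_apply, ofPoly_apply, coeff_mul, ofReal_sum]
  refine Finset.sum_congr rfl fun i _ => ?_
  rw [ofPoly_apply, ofPoly_apply, ofReal_mul_ofReal]

theorem ofPoly_pow (p : ℝ[X]) (s : ℕ) : ofPoly (p ^ s) = pow (ofPoly p) s := by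
  induction s with
  | zero => rw [pow_zero, ofPoly_one]; rfl
  | succ s ih => rw [pow_succ, ofPoly_mul, ih]; rfl

/-- The real polynomial formed by the `j`-th coordinates of the coefficients. -/
noncomputable def component (f : OctPoly) (j : Fin 8) : ℝ[X] :=
  ∑ i ∈ f.support, monomial i (coord (f i) j)

theorem coeff_component (f : OctPoly) (j : Fin 8) (k : ℕ) :
    (component f j).coeff k = coord (f k) j := by
  rw [component, finsetSum_coeff]
  simp only [coeff_monomial]
  rw [Finset.sum_ite_eq' f.support k]
  split_ifs with h
  · rfl
  · rw [Finsupp.notMem_support_iff.1 h]; simp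

theorem component_ofPoly_zero (p : ℝ[X]) : component (ofPoly p) 0 = p := by
  ext k
  rw [coeff_component, ofPoly_apply, coord_ofReal_zero]

theorem component_ofPoly_mul (p : ℝ[X]) (h : OctPoly) (j : Fin 8) :
    component (mul (ofPoly p) h) j = p * component h j := by
  ext k
  rw [coeff_component, mul_apply, coeff_mul, map_sum, Finset.sum_apply]
  refine Finset.sum_congr rfl fun i _ => ?_
  rw [ofPoly_apply, ofReal_mul_eq_smul, map_smul, coeff_component]
  rfl

/-- Multiplication by a real polynomial acts on each coordinate separately, so the real coordinate
of an octonionic quotient is already a quotient. -/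
theorem divides_ofPoly_iff {d p : ℝ[X]} : Divides (ofPoly d) (ofPoly p) ↔ d ∣ p := by
  constructor
  · rintro ⟨h, hh⟩
    refine ⟨component h 0, ?_⟩
    rw [← component_ofPoly_mul, ← hh, component_ofPoly_zero]
  · rintro ⟨q, rfl⟩
    exact ⟨ofPoly q, ofPoly_mul d q⟩

/-- The normal polynomial as a real polynomial. -/
noncomputable def realNormal (f : OctPoly) : ℝ[X] := ∑ j, component f j ^ 2

/-- The terms aᵢāⱼ and aⱼāᵢ add up to twice an inner product. Hence twice each coefficient is real,
and it matches the coefficient of ∑ pⱼ². -/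
theorem normal_eq_ofPoly (f : OctPoly) : normal f = ofPoly (realNormal f) := by
  ext1 k
  have hconj : ∀ i, conj f i = star (f i) := fun i => rfl
  have hsymm : normal f k + normal f k =
      ∑ p ∈ Finset.HasAntidiagonal.antidiagonal k, (f p.1 * star (f p.2) + f p.2 * star (f p.1)) := by
    rw [Finset.sum_add_distrib, normal, mul_apply]
    simp only [hconj]
    congr 1
    exact (Finset.Nat.sum_antidiagonal_swap (n := k)
      (f := fun p : ℕ × ℕ => f p.1 * star (f p.2))).symm
  have hcoeff : (realNormal f).coeff k =
      ∑ p ∈ Finset.HasAntidiagonal.antidiagonal k, ∑ j, coord (f p.1) j * coord (f p.2) j := by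
    rw [realNormal, finsetSum_coeff, Finset.sum_comm]
    refine Finset.sum_congr rfl fun j _ => ?_
    rw [sq, coeff_mul]
    simp only [coeff_component]
  simp only [mul_star_add_mul_star] at hsymm
  rw [← ofReal_sum, ← Finset.mul_sum, ← hcoeff, ← two_smul ℝ, ofReal, mul_smul] at hsymm
  rw [ofPoly_apply, ofReal]
  exact smul_right_injective _ (two_ne_zero (α := ℝ)) hsymm

theorem natDegree_component_le {f : OctPoly} {n : ℕ} (hf : f.HasDegree n) (j : Fin 8) :
    (component f j).natDegree ≤ n := by
  rw [natDegree_le_iff_coeff_eq_zero]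
  intro m hm
  rw [coeff_component, hf.2 m hm]
  simp

theorem coeff_realNormal {f : OctPoly} {n : ℕ} (hf : f.HasDegree n) :
    (realNormal f).coeff (2 * n) = (f n).normSq := by
  rw [realNormal, finsetSum_coeff, normSq_eq_sum]
  refine Finset.sum_congr rfl fun j _ => ?_
  rw [coeff_pow_of_natDegree_le (natDegree_component_le hf j), coeff_component]

/-- The top coefficients of the squares add up to |aₙ|², so they cannot cancel. -/
theorem natDegree_realNormal {f : OctPoly} {n : ℕ} (hf : f.HasDegree n) :
    (realNormal f).natDegree = 2 * n := by
  refine natDegree_eq_of_le_of_coeff_ne_zero ?_ ?_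
  · refine natDegree_sum_le_of_forall_le _ _ fun j _ => ?_
    exact natDegree_pow_le_of_le 2 (natDegree_component_le hf j)
  · rw [coeff_realNormal hf]
    exact fun h => hf.1 (normSq_eq_zero.1 h)

theorem realNormal_ne_zero {f : OctPoly} {n : ℕ} (hf : f.HasDegree n) : realNormal f ≠ 0 := by
  intro h
  have := coeff_realNormal hf
  rw [h, coeff_zero] at this
  exact hf.1 (normSq_eq_zero.1 this.symm)

/-- Only the real coordinate involves X, which gives (X − Re α)² + |Im α|². -/
theorem realNormal_linear (α : Octonion) :
    realNormal (linear α) = quadFactor α.toComplex := by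
  have h0 : component (linear α) 0 = X - C α.re := by
    ext k
    rw [coeff_component, linear, coeff_sub, coeff_X, coeff_C, Finsupp.sub_apply,
      Finsupp.single_apply, Finsupp.single_apply, map_sub]
    by_cases h1 : 1 = k
    · subst h1; simp [coord_apply]
    · by_cases h2 : k = 0
      · subst h2; simp [coord_apply, re]
      · simp [h1, h2, Ne.symm h2]
  have h1 : ∀ j, j ≠ 0 → component (linear α) j = -C (coord α j) := by
    intro j hj
    ext k
    rw [coeff_component, linear, coeff_neg, coeff_C, Finsupp.sub_apply,
      Finsupp.single_apply, Finsupp.single_apply, map_sub]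
    have : coord 1 j = 0 := by
      fin_cases j <;> simp_all [coord_apply]
    by_cases h1 : 1 = k
    · subst h1; simp [this]
    · by_cases h2 : k = 0
      · subst h2; simp
      · simp [h1, h2, Ne.symm h2]
  have h2 : Complex.normSq α.toComplex = ∑ j, coord α j ^ 2 := by
    rw [Complex.normSq_apply, toComplex, ← sq, ← sq, Octonion.abs_sq]
    simp [re, im, ofReal, coord_apply, Fin.sum_univ_eight, normSq, Quaternion.normSq_def']
    ring
  rw [realNormal, Fin.sum_univ_succ, h0, quadFactor, h2,
    Fin.sum_univ_succ (f := fun j => coord α j ^ 2), map_add, map_sum]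
  have h3 : ∀ j : Fin 7, component (linear α) j.succ ^ 2 = C (coord α j.succ ^ 2) := by
    intro j
    rw [h1 _ (Fin.succ_ne_zero j), neg_sq, C_pow]
  simp only [h3]
  have h4 : coord α 0 = α.re := rfl
  have h5 : α.toComplex.re = α.re := rfl
  rw [h4, h5, C_mul, C_pow]
  have : (C 2 : ℝ[X]) = 2 := rfl
  rw [this]
  ring

theorem isZeroOfMultiplicity_iff {f : OctPoly} (h0 : realNormal f ≠ 0) {α : Octonion}
    (hα : α ∈ f.zeroSet) {s : ℕ} :
    f.IsZeroOfMultiplicity α s ↔ s = quadOrder (realNormal f) α.toComplex := by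
  rw [IsZeroOfMultiplicity, charPoly, normal_eq_ofPoly (linear α), normal_eq_ofPoly f,
    realNormal_linear, ← ofPoly_pow, ← ofPoly_pow, divides_ofPoly_iff, divides_ofPoly_iff,
    quadFactor_pow_dvd_iff h0, quadFactor_pow_dvd_iff h0]
  constructor
  · rintro ⟨_, h1, h2⟩; omega
  · rintro rfl; exact ⟨hα, le_rfl, by omega⟩

theorem zeroMultiplicity_eq {f : OctPoly} (h0 : realNormal f ≠ 0) {α : Octonion}
    (hα : α ∈ f.zeroSet) : f.zeroMultiplicity α = quadOrder (realNormal f) α.toComplex := by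
  have : {s | f.IsZeroOfMultiplicity α s} = {quadOrder (realNormal f) α.toComplex} := by
    ext s
    exact isZeroOfMultiplicity_iff h0 hα
  rw [zeroMultiplicity, this, csSup_singleton]

/-! ### Values on a sphere and roots of the normal polynomial -/

/-- The octonion whose coordinates are the real parts of the component values at `z`. -/
noncomputable def evalRe (z : ℂ) (f : OctPoly) : Octonion := ∑ i ∈ f.support, (z ^ i).re • f i

/-- The octonion whose coordinates are the imaginary parts of the component values at `z`. -/
noncomputable def evalIm (z : ℂ) (f : OctPoly) : Octonion := ∑ i ∈ f.support, (z ^ i).im • f i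

theorem aeval_component (f : OctPoly) (z : ℂ) (j : Fin 8) :
    aeval z (component f j) = ⟨coord (evalRe z f) j, coord (evalIm z f) j⟩ := by
  have : aeval z (component f j) = ∑ i ∈ f.support, (coord (f i) j : ℂ) * z ^ i := by
    simp [component, aeval_monomial]
  rw [this]
  apply Complex.ext
  · simp [evalRe, Finset.sum_apply, mul_comm]
  · simp [evalIm, Finset.sum_apply, mul_comm]

theorem eval_ofReal_add_smul (f : OctPoly) (z : ℂ) {I : Octonion} (hI : I ∈ imagUnits) :
    eval (ofReal z.re + z.im • I) f = evalRe z f + I * evalIm z f := by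
  rw [eval, Finsupp.sum, evalRe, evalIm, Finset.mul_sum, ← Finset.sum_add_distrib]
  refine Finset.sum_congr rfl fun i _ => ?_
  rw [pow_ofReal_add_smul hI, add_mul, ofReal_mul_eq_smul, smul_mul, mul_smul']

/-- Squaring pⱼ(z) = bⱼ + i cⱼ and summing gives |b|² − |c|² + 2i⟨b, c⟩. -/
theorem aeval_realNormal_eq_zero_iff (f : OctPoly) (z : ℂ) :
    aeval z (realNormal f) = 0 ↔ (evalRe z f).normSq = (evalIm z f).normSq ∧
      ∑ j, coord (evalRe z f) j * coord (evalIm z f) j = 0 := by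
  have : aeval z (realNormal f) = ⟨(evalRe z f).normSq - (evalIm z f).normSq,
      2 * ∑ j, coord (evalRe z f) j * coord (evalIm z f) j⟩ := by
    rw [realNormal, map_sum]
    simp only [map_pow, aeval_component]
    rw [normSq_eq_sum, normSq_eq_sum, ← Finset.sum_sub_distrib, Finset.mul_sum]
    apply Complex.ext
    · rw [Complex.re_sum]
      change _ = ∑ j, (coord (evalRe z f) j ^ 2 - coord (evalIm z f) j ^ 2)
      refine Finset.sum_congr rfl fun j _ => ?_
      rw [sq, Complex.mul_re]; ring
    · rw [Complex.im_sum]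
      change _ = ∑ j, 2 * (coord (evalRe z f) j * coord (evalIm z f) j)
      refine Finset.sum_congr rfl fun j _ => ?_
      rw [sq, Complex.mul_im]; ring
  rw [this, Complex.ext_iff]
  simp [sub_eq_zero]

theorem exists_mem_zeroSet_iff (f : OctPoly) {z : ℂ} (hz : 0 ≤ z.im) :
    (∃ α ∈ f.zeroSet, α.toComplex = z) ↔ aeval z (realNormal f) = 0 := by
  rw [aeval_realNormal_eq_zero_iff, ← exists_imagUnit_add_mul_eq_zero_iff]
  constructor
  · rintro ⟨α, hα, rfl⟩
    obtain ⟨I, hI, h⟩ := exists_imagUnit α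
    refine ⟨I, hI, ?_⟩
    rw [← eval_ofReal_add_smul f _ hI]
    exact (congrArg (fun w => eval w f) h.symm).trans hα
  · rintro ⟨I, hI, h⟩
    exact ⟨_, (eval_ofReal_add_smul f z hI).trans h, toComplex_ofReal_add_smul hI _ hz⟩

theorem image_toComplex_zeroSet {f : OctPoly} (h0 : realNormal f ≠ 0) :
    toComplex '' f.zeroSet = upperRoots (realNormal f) := by
  ext z
  rw [Finset.mem_coe, mem_upperRoots h0]
  constructor
  · rintro ⟨α, hα, rfl⟩
    exact ⟨(exists_mem_zeroSet_iff f α.toComplex_im_nonneg).1 ⟨α, hα, rfl⟩, α.toComplex_im_nonneg⟩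
  · rintro ⟨h1, h2⟩
    exact (exists_mem_zeroSet_iff f h2).2 h1

theorem evalRe_eq_zero_and_evalIm_eq_zero {f : OctPoly} {α β : Octonion} (hα : α ∈ f.zeroSet)
    (hβ : β ∈ f.zeroSet) (hne : α ≠ β) (h : β.toComplex = α.toComplex) :
    evalRe α.toComplex f = 0 ∧ evalIm α.toComplex f = 0 := by
  obtain ⟨I, hI, hαI⟩ := exists_imagUnit α
  obtain ⟨J, hJ, hβJ⟩ := exists_imagUnit β
  have hαI' : α = ofReal α.toComplex.re + α.toComplex.im • I := hαI
  have hβJ' : β = ofReal α.toComplex.re + α.toComplex.im • J := by rw [← h]; exact hβJ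
  have hIJ : I ≠ J := by
    rintro rfl
    exact hne (hαI'.trans hβJ'.symm)
  refine eq_zero_of_add_mul_eq_zero hIJ ?_ ?_
  · rw [← eval_ofReal_add_smul f _ hI, ← hαI']; exact hα
  · rw [← eval_ofReal_add_smul f _ hJ, ← hβJ']; exact hβ

theorem conjClass_subset_zeroSet {f : OctPoly} {α : Octonion}
    (h : evalRe α.toComplex f = 0 ∧ evalIm α.toComplex f = 0) : α.conjClass ⊆ f.zeroSet := by
  rintro _ ⟨I, hI, rfl⟩
  have := eval_ofReal_add_smul f α.toComplex hI
  rw [h.1, h.2, mul_zero, add_zero] at this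
  exact this

theorem aeval_component_eq_zero {f : OctPoly} {α : Octonion} (hα : α ∈ f.sphericalZeros)
    (j : Fin 8) : aeval α.toComplex (component f j) = 0 := by
  obtain ⟨h1, h2, h3⟩ := hα
  obtain ⟨I, hI, hαI⟩ := exists_imagUnit α
  have him : α.im.abs ≠ 0 := fun h => h2 (isReal_iff.2 h)
  -- The antipode of α is a second zero on the sphere, distinct from α because α is not real.
  have hβ : ofReal α.re + α.im.abs • -I ∈ f.zeroSet := h3 ⟨-I, neg_mem_imagUnits hI, rfl⟩
  have hne : α ≠ ofReal α.re + α.im.abs • -I := by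
    intro h
    have h' : α.im.abs • I = α.im.abs • -I := add_left_cancel (hαI.symm.trans h)
    have h'' : I = -I := smul_right_injective _ him h'
    have hz : I = 0 := by
      have : (2 : ℝ) • I = 0 := by rw [two_smul]; nth_rewrite 2 [h'']; abel
      simpa using this
    have := (mem_imagUnits_iff.1 hI).2
    rw [hz] at this
    simp [normSq] at this
  have hθ : (ofReal α.re + α.im.abs • -I).toComplex = α.toComplex :=
    toComplex_ofReal_add_smul (neg_mem_imagUnits hI) _ (abs_nonneg _)
  obtain ⟨hre, him⟩ := evalRe_eq_zero_and_evalIm_eq_zero h1 hβ hne hθ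
  rw [aeval_component, hre, him]
  simp
  rfl

/-! ### Systems of zeros and their count -/

theorem eq_of_mem_isolatedZeros {f : OctPoly} {α β : Octonion} (hα : α ∈ f.isolatedZeros)
    (hβ : β ∈ f.zeroSet) (h : β.toComplex = α.toComplex) : α = β := by
  by_contra hne
  exact hα.2.2 (conjClass_subset_zeroSet
    (evalRe_eq_zero_and_evalIm_eq_zero hα.1 hβ hne h))

theorem realZeros_subset (f : OctPoly) : f.realZeros ⊆ f.zeroSet := fun _ h => h.1

theorem isolatedZeros_subset (f : OctPoly) : f.isolatedZeros ⊆ f.zeroSet := fun _ h => h.1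

theorem sphericalZeros_subset (f : OctPoly) : f.sphericalZeros ⊆ f.zeroSet := fun _ h => h.1

theorem mem_sphericalZeros_of_toComplex_eq {f : OctPoly} {α β : Octonion}
    (hα : α ∈ f.sphericalZeros) (h : β.toComplex = α.toComplex) : β ∈ f.sphericalZeros := by
  refine ⟨hα.2.2 (mem_conjClass_iff.2 h), ?_, ?_⟩
  · rw [isReal_iff, h, ← isReal_iff]; exact hα.2.1
  · rw [conjClass_eq_iff.2 h]; exact hα.2.2

theorem exists_isZeroSystem {f : OctPoly} (h0 : realNormal f ≠ 0) :
    ∃ R I S : Finset Octonion, f.IsZeroSystem R I S := by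
  have hfin : ∀ s ⊆ f.zeroSet, (toComplex '' s).Finite := fun s hs =>
    (Finset.finite_toSet _).subset
      ((Set.image_mono hs).trans (image_toComplex_zeroSet h0).subset)
  have hR : f.realZeros.Finite := Set.Finite.of_finite_image (hfin _ f.realZeros_subset)
    (toComplex_injOn_isReal.mono fun _ h => h.2)
  have hI : f.isolatedZeros.Finite := Set.Finite.of_finite_image (hfin _ f.isolatedZeros_subset)
    fun α hα β hβ h => eq_of_mem_isolatedZeros hα hβ.1 h.symm
  -- One representative is chosen in each class of spherical zeros.
  obtain ⟨S, hS, hbij⟩ := Set.exists_subset_bijOn f.sphericalZeros toComplex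
  have hSfin : S.Finite := Set.Finite.of_finite_image
    (hfin _ (hS.trans f.sphericalZeros_subset)) hbij.injOn
  refine ⟨hR.toFinset, hI.toFinset, hSfin.toFinset, by simp, by simp, by simpa using hS, ?_, ?_⟩
  · intro β hβ γ hγ hne h
    rw [Set.Finite.mem_toFinset] at hβ hγ
    exact hne (hbij.injOn hβ hγ (mem_conjClass_iff.1 h))
  · ext α
    simp only [Set.mem_iUnion, Set.Finite.mem_toFinset, mem_conjClass_iff, exists_prop]
    constructor
    · rintro ⟨β, hβ, h⟩
      exact mem_sphericalZeros_of_toComplex_eq (hS hβ) h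
    · intro hα
      obtain ⟨β, hβ, h⟩ := hbij.surjOn ⟨α, hα, rfl⟩
      exact ⟨β, hβ, h.symm⟩

namespace IsZeroSystem

variable {f : OctPoly} {R I S : Finset Octonion}

/-- The listed zeros correspond bijectively to the upper roots. The weight m is left free: m = 1
counts classes, m = `quadOrder` gives the degree. -/
theorem sum_eq (h : f.IsZeroSystem R I S) (h0 : realNormal f ≠ 0) (m : ℂ → ℕ) :
    ∑ α ∈ R, m α.toComplex + ∑ α ∈ I, m α.toComplex + ∑ α ∈ S, m α.toComplex =
      ∑ z ∈ upperRoots (realNormal f), m z := by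
  classical
  have hR : ∀ α, α ∈ R ↔ α ∈ f.realZeros := fun α => by rw [← h.coe_real, Finset.mem_coe]
  have hI : ∀ α, α ∈ I ↔ α ∈ f.isolatedZeros := fun α => by rw [← h.coe_isolated, Finset.mem_coe]
  have hS : ∀ α ∈ S, α ∈ f.sphericalZeros := fun α hα => h.spherical_subset hα
  have hRI : Disjoint R I := Finset.disjoint_left.2 fun α h1 h2 =>
    ((hI α).1 h2).2.1 ((hR α).1 h1).2
  have hRIS : Disjoint (R ∪ I) S := Finset.disjoint_left.2 fun α h1 h2 => by
    rcases Finset.mem_union.1 h1 with h1 | h1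
    · exact (hS α h2).2.1 ((hR α).1 h1).2
    · exact ((hI α).1 h1).2.2 (hS α h2).2.2
  rw [← Finset.sum_union hRI, ← Finset.sum_union hRIS]
  have hinj : Set.InjOn toComplex (R ∪ I ∪ S : Finset Octonion) := by
    have hzero : ∀ α ∈ R ∪ I ∪ S, α ∈ f.zeroSet := by
      intro α hα
      rcases Finset.mem_union.1 hα with hα | hα
      · rcases Finset.mem_union.1 hα with hα | hα
        · exact ((hR α).1 hα).1
        · exact ((hI α).1 hα).1
      · exact (hS α hα).1
    have hreal : ∀ α ∈ R ∪ I ∪ S, α.IsReal → α ∈ R := fun α hα hr => (hR α).2 ⟨hzero α hα, hr⟩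
    intro α hα β hβ hαβ
    by_cases hr : α.IsReal
    · refine toComplex_injOn_isReal hr ?_ hαβ
      rw [Set.mem_ofPred_eq, isReal_iff, ← hαβ, ← isReal_iff]; exact hr
    have hr' : ¬ β.IsReal := by rwa [isReal_iff, ← hαβ, ← isReal_iff]
    have hmem : ∀ γ ∈ R ∪ I ∪ S, ¬ γ.IsReal → γ ∈ I ∨ γ ∈ S := by
      intro γ hγ hγr
      rcases Finset.mem_union.1 hγ with hγ | hγ
      · rcases Finset.mem_union.1 hγ with hγ | hγ
        · exact absurd ((hR γ).1 hγ).2 hγr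
        · exact Or.inl hγ
      · exact Or.inr hγ
    rcases hmem α hα hr with h1 | h1
    · exact eq_of_mem_isolatedZeros ((hI α).1 h1) (hzero β hβ) hαβ.symm
    rcases hmem β hβ hr' with h2 | h2
    · exact (eq_of_mem_isolatedZeros ((hI β).1 h2) (hzero α hα) hαβ).symm
    by_contra hne
    exact h.nonconjugate α h1 β h2 hne (mem_conjClass_iff.2 hαβ)
  have himage : (R ∪ I ∪ S).image toComplex = upperRoots (realNormal f) := by
    rw [← Finset.coe_inj, ← image_toComplex_zeroSet h0, Finset.coe_image]
    apply Set.Subset.antisymm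
    · refine Set.image_mono fun α hα => ?_
      rcases Finset.mem_union.1 hα with hα | hα
      · rcases Finset.mem_union.1 hα with hα | hα
        · exact ((hR α).1 hα).1
        · exact ((hI α).1 hα).1
      · exact (hS α hα).1
    · rintro _ ⟨α, hα, rfl⟩
      by_cases hr : α.IsReal
      · exact ⟨α, by simp [(hR α).2 ⟨hα, hr⟩], rfl⟩
      by_cases hs : α.conjClass ⊆ f.zeroSet
      · have hsph : α ∈ f.sphericalZeros := ⟨hα, hr, hs⟩
        rw [← h.cover] at hsph
        simp only [Set.mem_iUnion, exists_prop] at hsph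
        obtain ⟨β, hβ, hαβ⟩ := hsph
        exact ⟨β, by simp [hβ], (mem_conjClass_iff.1 hαβ).symm⟩
      · exact ⟨α, by simp [(hI α).2 ⟨hα, hr, hs⟩], rfl⟩
  rw [← himage, Finset.sum_image hinj]

theorem sum_zeroMultiplicity (h : f.IsZeroSystem R I S) (h0 : realNormal f ≠ 0) :
    ∑ α ∈ R, f.zeroMultiplicity α + ∑ α ∈ I, f.zeroMultiplicity α +
        ∑ α ∈ S, f.zeroMultiplicity α =
      ∑ z ∈ upperRoots (realNormal f), quadOrder (realNormal f) z := by
  rw [← h.sum_eq h0]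
  congr 1
  · congr 1
    · refine Finset.sum_congr rfl fun α hα => zeroMultiplicity_eq h0 ?_
      exact f.realZeros_subset (h.coe_real ▸ Finset.mem_coe.2 hα)
    · refine Finset.sum_congr rfl fun α hα => zeroMultiplicity_eq h0 ?_
      exact f.isolatedZeros_subset (h.coe_isolated ▸ Finset.mem_coe.2 hα)
  · refine Finset.sum_congr rfl fun α hα => zeroMultiplicity_eq h0 ?_
    exact f.sphericalZeros_subset (h.spherical_subset hα)

end IsZeroSystem

theorem one_le_zeroMultiplicity {f : OctPoly} (h0 : realNormal f ≠ 0) {α : Octonion}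
    (hα : α ∈ f.zeroSet) : 1 ≤ f.zeroMultiplicity α := by
  rw [zeroMultiplicity_eq h0 hα]
  exact one_le_quadOrder _ h0 ((exists_mem_zeroSet_iff f α.toComplex_im_nonneg).1 ⟨α, hα, rfl⟩)

theorem two_le_zeroMultiplicity {f : OctPoly} (h0 : realNormal f ≠ 0) {α : Octonion}
    (hα : α ∈ f.sphericalZeros) : 2 ≤ f.zeroMultiplicity α := by
  rw [zeroMultiplicity_eq h0 hα.1]
  exact two_le_quadOrder _ h0 (fun h => hα.2.1 (isReal_iff.2 h)) (aeval_component_eq_zero hα)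

/-- Conjugacy classes are the fibres of `toComplex`. -/
theorem ncard_conjClass_image_zeroSet {f : OctPoly} (h0 : realNormal f ≠ 0) :
    (conjClass '' f.zeroSet).Finite ∧
      (conjClass '' f.zeroSet).ncard = (upperRoots (realNormal f)).card := by
  have himage : (fun z => {x | toComplex x = z}) '' (upperRoots (realNormal f) : Set ℂ) =
      conjClass '' f.zeroSet := by
    rw [← image_toComplex_zeroSet h0, Set.image_image]
    refine Set.image_congr fun α _ => ?_
    ext β
    exact mem_conjClass_iff.symm
  rw [← himage]
  refine ⟨(Finset.finite_toSet _).image _, ?_⟩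
  rw [Set.InjOn.ncard_image, Set.ncard_coe_finset]
  rw [← image_toComplex_zeroSet h0]
  rintro _ ⟨α, _, rfl⟩ z _ h
  have : α ∈ {x | toComplex x = α.toComplex} := rfl
  rw [Set.ext_iff] at h
  exact (h α).1 this

end OctPoly

open Polynomial in
theorem theorem4p1 (f : OctPoly) (n : ℕ) (hn : 0 < n) (hf : f.HasDegree n) :
    -- the zero set is nonempty, and it meets at most `n` conjugacy classes
    f.zeroSet.Nonempty ∧
    (Octonion.conjClass '' f.zeroSet).Finite ∧
    (Octonion.conjClass '' f.zeroSet).ncard ≤ n ∧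
    -- the multiplicity of each zero is well defined
    (∀ α ∈ f.zeroSet, ∃! s : ℕ, f.IsZeroOfMultiplicity α s) ∧
    -- the zeros can be listed as described, and every such list has the claimed properties
    (∃ R I S : Finset Octonion, f.IsZeroSystem R I S) ∧
    ∀ R I S : Finset Octonion, f.IsZeroSystem R I S →
      (Octonion.conjClass '' f.zeroSet).ncard = R.card + I.card + S.card ∧
      (∑ α ∈ R, f.zeroMultiplicity α) + (∑ α ∈ I, f.zeroMultiplicity α)
        + (∑ α ∈ S, f.zeroMultiplicity α) = n ∧
      R.card + I.card + 2 * S.card ≤ n := by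
  have h0 := OctPoly.realNormal_ne_zero hf
  have hsum : ∑ z ∈ upperRoots f.realNormal, quadOrder f.realNormal z = n := by
    have h1 : 2 * ∑ z ∈ upperRoots f.realNormal, quadOrder f.realNormal z =
      f.realNormal.natDegree := sum_quadOrder_upperRoots _ h0
    have h2 := OctPoly.natDegree_realNormal hf
    omega
  obtain ⟨hfin, hcard⟩ := OctPoly.ncard_conjClass_image_zeroSet h0
  refine ⟨?_, hfin, ?_, ?_, OctPoly.exists_isZeroSystem h0, ?_⟩
  · rw [← Set.image_nonempty (f := Octonion.toComplex), OctPoly.image_toComplex_zeroSet h0,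
      Finset.coe_nonempty, Finset.nonempty_iff_ne_empty]
    -- Without roots the sum of the orders would be empty, but it equals n > 0.
    intro h
    rw [h, Finset.sum_empty] at hsum
    omega
  · rw [hcard, ← hsum, Finset.card_eq_sum_ones]
    exact Finset.sum_le_sum fun z hz => one_le_quadOrder _ h0 ((mem_upperRoots h0).1 hz).1
  · intro α hα
    exact ⟨_, (OctPoly.isZeroOfMultiplicity_iff h0 hα).2 rfl, fun s hs =>
      (OctPoly.isZeroOfMultiplicity_iff h0 hα).1 hs⟩
  · intro R I S h
    have hn' := (h.sum_zeroMultiplicity h0).trans hsum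
    refine ⟨?_, hn', ?_⟩
    · rw [hcard]
      simpa using (h.sum_eq h0 fun _ => 1).symm
    · have hR : R.card • 1 ≤ ∑ α ∈ R, f.zeroMultiplicity α :=
        Finset.card_nsmul_le_sum _ _ _ fun α hα => OctPoly.one_le_zeroMultiplicity h0
          (f.realZeros_subset (h.coe_real ▸ Finset.mem_coe.2 hα))
      have hI : I.card • 1 ≤ ∑ α ∈ I, f.zeroMultiplicity α :=
        Finset.card_nsmul_le_sum _ _ _ fun α hα => OctPoly.one_le_zeroMultiplicity h0
          (f.isolatedZeros_subset (h.coe_isolated ▸ Finset.mem_coe.2 hα))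
      have hS : S.card • 2 ≤ ∑ α ∈ S, f.zeroMultiplicity α :=
        Finset.card_nsmul_le_sum _ _ _ fun α hα => OctPoly.two_le_zeroMultiplicity h0
          (h.spherical_subset hα)
      simp only [smul_eq_mul] at hR hI hS
      omega
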